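/- Let $\varepsilon>0$ and $\delta=(2\varepsilon)^{3/2}$. Let $\gamma$ denote the standard Gaussian distribution on $\mathbb{R}$, and let $\mu$ be the function on $\mathbb{R}$ given, for $z$ with $|z|\in[i\delta,(i+1)\delta)$, $i\in\{0,1,2,\dots\}$, by $$\mu(z)=\frac{\gamma\big([i\delta,(i+1)\delta)\big)}{\delta}.$$ Then $\mu$ is a (symmetric) probability density on $\mathbb{R}$. Moreover, let $k\in\mathbb{N}$, write $\mu^k$ for the $k$-fold product of the distribution with density $\mu$ and $\mathcal{N}^k$ for the standard Gaussian distribution on $\mathbb{R}^k$. For every semi-norm $\varphi:\mathbb{R}^k\to\mathbb{R}$ (that is, $\varphi(x+y)\le\varphi(x)+\varphi(y)$ and $\varphi(ax)=|a|\varphi(x)$ for all $x,y\in\mathbb{R}^k$, $a\in\mathbb{R}$), both expectations below are finite and $$(1-\varepsilon)\,\mathbb{E}_{X\sim\mu^k}[\varphi(X)]\;\le\;\mathbb{E}_{Z\sim\mathcal{N}^k}[\varphi(Z)]\;\le\;\mathbb{E}_{X\sim\mu^k}[\varphi(X)].$$ -/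

import Mathlib

open MeasureTheory ProbabilityTheory

/-- The piecewise-flat approximator to the standard Gaussian density: for `z` with
`|z| ∈ [iδ, (i+1)δ)`, i.e. `i = ⌊|z|/δ⌋₊`, its value is the standard Gaussian mass of
`[iδ, (i+1)δ)` divided by `δ`. It is even in `z` by construction. -/
noncomputable def flatDensity (δ z : ℝ) : ℝ :=
  (gaussianReal 0 1).real
    (Set.Ico ((⌊|z| / δ⌋₊ : ℝ) * δ) (((⌊|z| / δ⌋₊ : ℝ) + 1) * δ)) / δ

/-- The distribution on `ℝ` whose density with respect to Lebesgue measure is `flatDensity δ`. -/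
noncomputable def flatMeasure (δ : ℝ) : Measure ℝ :=
  volume.withDensity (fun z => ENNReal.ofReal (flatDensity δ z))

/-- The `k`-fold product of the distribution `flatMeasure δ`. -/
noncomputable def flatProd (k : ℕ) (δ : ℝ) : Measure (Fin k → ℝ) :=
  Measure.pi (fun _ => flatMeasure δ)

/-- The standard Gaussian distribution on `ℝ^k`: independent standard normal coordinates. -/
noncomputable def stdGaussianProd (k : ℕ) : Measure (Fin k → ℝ) :=
  Measure.pi (fun _ => gaussianReal 0 1)

/-! If two symmetric laws on the line have stochastically ordered absolute values, their products
are ordered on nonnegative convex functions: exchange the marginals through Fubini, each exchange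
being one-dimensional (`lintegral_pi_le_of_convexOn`). Both inequalities are instances of this.

Upper bound: on the half-line the distribution function of the flat law is the piecewise linear
interpolation of the Gaussian one at multiples of `δ`. The latter is concave, so the interpolation
lies below it and the flat law is the more spread out.

Lower bound: dilate the flat law by `c = 1 - ε`; homogeneity of the seminorm turns the dilation into
the factor `c`. The order of the absolute values reduces to a lower bound on the Gaussian mass of
each cell (`gaussianReal_Ico_le_flatMeasure`), which the relation `δ ^ 2 = 8 * ε ^ 3` supplies
(`slope_bound`). -/

/-! ### Stochastic order and integrals of convex functions -/

theorem ConvexOn.continuous_of_univ {E : Type*} [NormedAddCommGroup E] [NormedSpace ℝ E]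
    [FiniteDimensional ℝ E] {f : E → ℝ} (hf : ConvexOn ℝ Set.univ f) : Continuous f :=
  continuousOn_univ.1 (hf.continuousOn isOpen_univ)

theorem ConvexOn.le_of_even_of_abs_le {f : ℝ → ℝ} (hf : ConvexOn ℝ Set.univ f)
    (heven : ∀ x, f (-x) = f x) {x y : ℝ} (h : |x| ≤ |y|) : f x ≤ f y := by
  have hy : f |y| = f y := by
    rcases abs_choice y with h | h <;> rw [h]
    exact heven y
  have hx : x ∈ segment ℝ (-|y|) |y| := by
    rw [segment_eq_Icc (by linarith [abs_nonneg y])]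
    exact abs_le.1 h
  have := hf.le_max_of_mem_segment (Set.mem_univ _) (Set.mem_univ _) hx
  rwa [heven, max_self, hy] at this

/-- If `|x|` is stochastically smaller under `m₁` than under `m₂`, then even convex nonnegative
functions have smaller integral under `m₁`. -/
theorem lintegral_le_of_even_of_convexOn {m₁ m₂ : Measure ℝ} [IsProbabilityMeasure m₁]
    [IsProbabilityMeasure m₂]
    (hle : ∀ s, 0 ≤ s → m₁ {x | s < |x|} ≤ m₂ {x | s < |x|})
    {f : ℝ → ℝ} (hf : ConvexOn ℝ Set.univ f) (heven : ∀ x, f (-x) = f x) (hpos : ∀ x, 0 ≤ f x) :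
    ∫⁻ x, ENNReal.ofReal (f x) ∂m₁ ≤ ∫⁻ x, ENNReal.ofReal (f x) ∂m₂ := by
  have hc : Continuous f := hf.continuous_of_univ
  rw [lintegral_eq_lintegral_meas_lt _ (ae_of_all _ hpos) hc.aemeasurable,
    lintegral_eq_lintegral_meas_lt _ (ae_of_all _ hpos) hc.aemeasurable]
  refine lintegral_mono fun t => ?_
  have habs (x : ℝ) : f |x| = f x :=
    le_antisymm (hf.le_of_even_of_abs_le heven (by simp)) (hf.le_of_even_of_abs_le heven (by simp))
  set S : Set ℝ := {s | 0 ≤ s ∧ f s ≤ t} with hS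
  have hSc : IsClosed S :=
    (isClosed_le continuous_const continuous_id).inter (isClosed_le hc continuous_const)
  have hmem (x : ℝ) : |x| ∈ S ↔ f x ≤ t := by simp [hS, habs]
  -- Layer-cake: superlevel sets are compared one `t` at a time. As `f` is monotone in `|x|`, `S` is
  -- empty, `[0, sSup S]` or the whole half-line.
  rcases S.eq_empty_or_nonempty with h0 | hne
  · have : {x | t < f x} = Set.univ := by
      ext x
      have := hmem x
      rw [h0] at this
      simpa using this
    simp [this]
  by_cases hb : BddAbove S
  · have hsup := hSc.csSup_mem hne hb
    have : {x | t < f x} = {x | sSup S < |x|} := by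
      ext x
      simp only [Set.mem_ofPred_eq]
      rw [← not_le, ← not_le, ← hmem]
      refine not_congr ⟨fun h => le_csSup hb h, fun h => ?_⟩
      refine (hmem x).2 (le_trans (hf.le_of_even_of_abs_le heven ?_) hsup.2)
      rwa [abs_of_nonneg hsup.1]
    rw [this]
    exact hle _ hsup.1
  · have : {x | t < f x} = ∅ := by
      ext x
      simp only [Set.mem_ofPred_eq, Set.mem_empty_iff_false, iff_false, not_lt]
      rw [not_bddAbove_iff] at hb
      obtain ⟨y, hy, hxy⟩ := hb |x|
      refine le_trans (hf.le_of_even_of_abs_le heven ?_) hy.2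
      rw [abs_of_nonneg hy.1]
      exact hxy.le
    simp [this]

theorem lintegral_ofReal_symmetrize {m : Measure ℝ} (hm : m.map (fun x => -x) = m)
    {f : ℝ → ℝ} (hf : Measurable f) (hpos : ∀ x, 0 ≤ f x) :
    ∫⁻ x, ENNReal.ofReal (f x + f (-x)) ∂m = 2 * ∫⁻ x, ENNReal.ofReal (f x) ∂m := by
  have h : ∫⁻ x, ENNReal.ofReal (f (-x)) ∂m = ∫⁻ x, ENNReal.ofReal (f x) ∂m := by
    conv_rhs => rw [← hm]
    rw [lintegral_map (by fun_prop) (by fun_prop)]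
  simp_rw [fun x => ENNReal.ofReal_add (hpos x) (hpos (-x))]
  rw [lintegral_add_left (by fun_prop), h, two_mul]

/-- Evenness can be dropped: `f x + f (-x)` is even and convex, and by symmetry of the measures its
integral is twice that of `f`. -/
theorem lintegral_le_of_convexOn {m₁ m₂ : Measure ℝ} [IsProbabilityMeasure m₁]
    [IsProbabilityMeasure m₂] (h₁ : m₁.map (fun x => -x) = m₁) (h₂ : m₂.map (fun x => -x) = m₂)
    (hle : ∀ s, 0 ≤ s → m₁ {x | s < |x|} ≤ m₂ {x | s < |x|})
    {f : ℝ → ℝ} (hf : ConvexOn ℝ Set.univ f) (hpos : ∀ x, 0 ≤ f x) :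
    ∫⁻ x, ENNReal.ofReal (f x) ∂m₁ ≤ ∫⁻ x, ENNReal.ofReal (f x) ∂m₂ := by
  have hc : Measurable f := hf.continuous_of_univ.measurable
  have hneg : ConvexOn ℝ Set.univ (fun x => f (-x)) := by
    simpa [Function.comp_def] using hf.comp_linearMap (-LinearMap.id)
  have := lintegral_le_of_even_of_convexOn hle (hf.add hneg)
    (fun x => by simp [add_comm]) (fun x => add_nonneg (hpos _) (hpos _))
  simp only [Pi.add_apply] at this
  rw [lintegral_ofReal_symmetrize h₁ hc hpos, lintegral_ofReal_symmetrize h₂ hc hpos] at this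
  exact (ENNReal.mul_le_mul_iff_right (by simp) (by simp)).1 this

theorem lintegral_pi_fin_succ (m : Measure ℝ) [SigmaFinite m] (k : ℕ)
    {f : (Fin (k + 1) → ℝ) → ENNReal} (hf : Measurable f) :
    ∫⁻ x, f x ∂(Measure.pi fun _ => m) =
      ∫⁻ x, ∫⁻ y, f (Fin.cons x y) ∂(Measure.pi fun _ => m) ∂m := by
  have h := (measurePreserving_piFinSuccAbove (fun _ : Fin (k + 1) => m) 0).symm
  rw [← h.lintegral_comp hf, lintegral_prod]
  · simp [MeasurableEquiv.piFinSuccAbove, Fin.insertNthEquiv]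
  · exact (hf.comp (MeasurableEquiv.measurable _)).aemeasurable

/-- Comparison of product measures on nonnegative convex functions when the symmetric marginals
are stochastically ordered in absolute value. -/
theorem lintegral_pi_le_of_convexOn {m₁ m₂ : Measure ℝ} [IsProbabilityMeasure m₁]
    [IsProbabilityMeasure m₂] (h₁ : m₁.map (fun x => -x) = m₁) (h₂ : m₂.map (fun x => -x) = m₂)
    (hle : ∀ s, 0 ≤ s → m₁ {x | s < |x|} ≤ m₂ {x | s < |x|}) (k : ℕ)
    {f : (Fin k → ℝ) → ℝ} (hf : ConvexOn ℝ Set.univ f) (hpos : ∀ x, 0 ≤ f x) :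
    ∫⁻ x, ENNReal.ofReal (f x) ∂(Measure.pi fun _ => m₁) ≤
      ∫⁻ x, ENNReal.ofReal (f x) ∂(Measure.pi fun _ => m₂) := by
  induction k with
  | zero =>
    rw [Measure.pi_of_empty (fun _ : Fin 0 => m₁), Measure.pi_of_empty (fun _ : Fin 0 => m₂)]
  | succ k ih =>
    have hfm : Measurable f := hf.continuous_of_univ.measurable
    have hcons : Measurable fun p : ℝ × (Fin k → ℝ) => ENNReal.ofReal (f (Fin.cons p.1 p.2)) := by
      have : Measurable fun p : ℝ × (Fin k → ℝ) => (Fin.cons p.1 p.2 : Fin (k + 1) → ℝ) := by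
        refine measurable_pi_iff.2 fun i => Fin.cases ?_ (fun i => ?_) i
        · simpa using measurable_fst
        · simp only [Fin.cons_succ]
          fun_prop
      exact (hfm.comp this).ennreal_ofReal
    have hcomb (a b x x' : ℝ) (y y' : Fin k → ℝ) :
        (Fin.cons (a * x + b * x') (a • y + b • y') : Fin (k + 1) → ℝ) =
          a • Fin.cons x y + b • Fin.cons x' y' := by
      ext i
      refine Fin.cases ?_ (fun i => ?_) i <;> simp
    rw [lintegral_pi_fin_succ m₁ k (by fun_prop), lintegral_pi_fin_succ m₂ k (by fun_prop)]
    -- The tail is exchanged with the first coordinate frozen, then the first coordinate with the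
    -- tail frozen; slices of a convex function are convex.
    calc ∫⁻ x, ∫⁻ y, ENNReal.ofReal (f (Fin.cons x y)) ∂(Measure.pi fun _ => m₁) ∂m₁
        ≤ ∫⁻ x, ∫⁻ y, ENNReal.ofReal (f (Fin.cons x y)) ∂(Measure.pi fun _ => m₂) ∂m₁ := by
          refine lintegral_mono fun x => ih ⟨convex_univ, ?_⟩ fun y => hpos _
          intro y _ y' _ a b ha hb hab
          have := hcomb a b x x y y'
          rw [← add_mul, hab, one_mul] at this
          simp only [this]
          exact hf.2 trivial trivial ha hb hab
      _ = ∫⁻ y, ∫⁻ x, ENNReal.ofReal (f (Fin.cons x y)) ∂m₁ ∂(Measure.pi fun _ => m₂) :=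
          lintegral_lintegral_swap hcons.aemeasurable
      _ ≤ ∫⁻ y, ∫⁻ x, ENNReal.ofReal (f (Fin.cons x y)) ∂m₂ ∂(Measure.pi fun _ => m₂) := by
          refine lintegral_mono fun y => lintegral_le_of_convexOn h₁ h₂ hle ⟨convex_univ, ?_⟩
            fun x => hpos _
          intro x _ x' _ a b ha hb hab
          have := hcomb a b x x' y y
          rw [← add_smul, hab, one_smul] at this
          simp only [smul_eq_mul, this]
          exact hf.2 trivial trivial ha hb hab
      _ = _ := (lintegral_lintegral_swap hcons.aemeasurable).symm

/-! ### Symmetric measures without atoms -/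

theorem measureReal_Icc_neg_eq {m : Measure ℝ} [IsFiniteMeasure m] [NullSingletonClass m]
    (hm : m.map (fun x => -x) = m) {s : ℝ} (hs : 0 ≤ s) :
    m.real (Set.Icc (-s) s) = 2 * m.real (Set.Ico 0 s) := by
  have h : m (Set.Ioc (-s) 0) = m (Set.Ico 0 s) := by
    conv_lhs => rw [← hm]
    rw [Measure.map_apply measurable_neg measurableSet_Ioc]
    simp
  have h' : m.real (Set.Ioc (-s) 0) = m.real (Set.Ico 0 s) := congrArg ENNReal.toReal h
  have e₁ : m.real (Set.Icc (-s) s) = m.real (Set.Ioc (-s) s) :=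
    measureReal_congr Ioc_ae_eq_Icc.symm
  have e₂ : m.real (Set.Ico 0 s) = m.real (Set.Ioc 0 s) := measureReal_congr Ico_ae_eq_Ioc
  rw [e₁, ← Set.Ioc_union_Ioc_eq_Ioc (neg_nonpos.2 hs) hs,
    measureReal_union (Set.Ioc_disjoint_Ioc_of_le le_rfl) measurableSet_Ioc, h', ← e₂, two_mul]

/-- The measures of the central intervals determine the stochastic order of `|x|`. -/
theorem measure_lt_abs_le {m₁ m₂ : Measure ℝ} [IsProbabilityMeasure m₁]
    [IsProbabilityMeasure m₂] [NullSingletonClass m₁] [NullSingletonClass m₂]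
    (h₁ : m₁.map (fun x => -x) = m₁) (h₂ : m₂.map (fun x => -x) = m₂)
    {s t : ℝ} (hs : 0 ≤ s) (ht : 0 ≤ t)
    (h : m₂.real (Set.Ico 0 t) ≤ m₁.real (Set.Ico 0 s)) :
    m₁ {x | s < |x|} ≤ m₂ {x | t < |x|} := by
  have hset (s : ℝ) : {x : ℝ | s < |x|} = (Set.Icc (-s) s)ᶜ := by
    ext x
    simp [← abs_le]
  rw [hset, hset, ← ENNReal.toReal_le_toReal (by finiteness) (by finiteness)]
  change m₁.real _ ≤ m₂.real _
  rw [probReal_compl_eq_one_sub measurableSet_Icc, probReal_compl_eq_one_sub measurableSet_Icc,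
    measureReal_Icc_neg_eq h₁ hs, measureReal_Icc_neg_eq h₂ ht]
  linarith

/-! ### Bounds for Gaussian masses of intervals -/

theorem gaussianPDFReal_zero_one (x : ℝ) :
    gaussianPDFReal 0 1 x = (√(2 * Real.pi))⁻¹ * Real.exp (-x ^ 2 / 2) := by
  simp [gaussianPDFReal]

theorem continuous_gaussianPDFReal_zero_one : Continuous (gaussianPDFReal 0 1) := by
  rw [funext gaussianPDFReal_zero_one]
  fun_prop

theorem gaussianPDFReal_zero_one_anti {x y : ℝ} (hx : 0 ≤ x) (hxy : x ≤ y) :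
    gaussianPDFReal 0 1 y ≤ gaussianPDFReal 0 1 x := by
  rw [gaussianPDFReal_zero_one, gaussianPDFReal_zero_one]
  gcongr

theorem measureReal_gaussianReal_Ico {u v : ℝ} (h : u ≤ v) :
    (gaussianReal 0 1).real (Set.Ico u v) = ∫ x in u..v, gaussianPDFReal 0 1 x := by
  rw [measureReal_def, gaussianReal_apply_eq_integral 0 one_ne_zero, ENNReal.toReal_ofReal,
    intervalIntegral.integral_of_le h, integral_Ico_eq_integral_Ioc]
  exact integral_nonneg fun x => gaussianPDFReal_nonneg 0 1 x

theorem measureReal_gaussianReal_Ico_le {u v : ℝ} (hu : 0 ≤ u) (h : u ≤ v) :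
    (gaussianReal 0 1).real (Set.Ico u v) ≤ gaussianPDFReal 0 1 u * (v - u) := by
  rw [measureReal_gaussianReal_Ico h]
  have := intervalIntegral.integral_mono_on (μ := volume) h
    (continuous_gaussianPDFReal_zero_one.intervalIntegrable _ _)
    (intervalIntegrable_const (c := gaussianPDFReal 0 1 u))
    fun x hx => gaussianPDFReal_zero_one_anti hu hx.1
  simpa [mul_comm] using this

theorem le_measureReal_gaussianReal_Ico {u v : ℝ} (hu : 0 ≤ u) (h : u ≤ v) :
    gaussianPDFReal 0 1 v * (v - u) ≤ (gaussianReal 0 1).real (Set.Ico u v) := by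
  rw [measureReal_gaussianReal_Ico h]
  have := intervalIntegral.integral_mono_on (μ := volume) h
    (intervalIntegrable_const (c := gaussianPDFReal 0 1 v))
    (continuous_gaussianPDFReal_zero_one.intervalIntegrable _ _)
    fun x hx => gaussianPDFReal_zero_one_anti (hu.trans hx.1) hx.2
  simpa [mul_comm] using this

/-- A lower bound from `exp (-y) ≥ 1 - y`. -/
theorem le_measureReal_gaussianReal_Ico_of_cubic {u v : ℝ} (h : u ≤ v) :
    gaussianPDFReal 0 1 u * ((v - u) * (1 + u ^ 2 / 2) - (v ^ 3 - u ^ 3) / 6) ≤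
      (gaussianReal 0 1).real (Set.Ico u v) := by
  rw [measureReal_gaussianReal_Ico h]
  have hmono := intervalIntegral.integral_mono_on (μ := volume) h
    (f := fun x => gaussianPDFReal 0 1 u * ((1 + u ^ 2 / 2) - x ^ 2 / 2))
    (Continuous.intervalIntegrable (by fun_prop) _ _)
    (continuous_gaussianPDFReal_zero_one.intervalIntegrable _ _) fun x hx => by
      have hexp : gaussianPDFReal 0 1 x =
          gaussianPDFReal 0 1 u * Real.exp ((u ^ 2 - x ^ 2) / 2) := by
        rw [gaussianPDFReal_zero_one, gaussianPDFReal_zero_one, mul_assoc, ← Real.exp_add]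
        ring_nf
      rw [hexp]
      refine mul_le_mul_of_nonneg_left ?_ (gaussianPDFReal_nonneg 0 1 u)
      linarith [Real.add_one_le_exp ((u ^ 2 - x ^ 2) / 2)]
  refine le_trans (le_of_eq ?_) hmono
  rw [intervalIntegral.integral_const_mul, intervalIntegral.integral_sub
    intervalIntegrable_const (Continuous.intervalIntegrable (by fun_prop) _ _)]
  simp only [intervalIntegral.integral_const, intervalIntegral.integral_div, integral_pow,
    smul_eq_mul]
  norm_num
  left
  ring

/-! ### The flat measure: symmetry, masses of cells, total mass -/

theorem floor_abs_div_eq {δ z : ℝ} (hδ : 0 < δ) {i : ℕ}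
    (hz : z ∈ Set.Ico ((i : ℝ) * δ) (((i : ℝ) + 1) * δ)) : ⌊|z| / δ⌋₊ = i := by
  have h0 : 0 ≤ z := le_trans (by positivity) hz.1
  rw [abs_of_nonneg h0, Nat.floor_eq_iff (by positivity), le_div_iff₀ hδ, div_lt_iff₀ hδ]
  exact hz

theorem measurable_flatDensity (δ : ℝ) : Measurable (flatDensity δ) := by
  have h : Measurable fun z : ℝ => ⌊|z| / δ⌋₊ := by fun_prop
  exact (measurable_from_nat (f := fun n : ℕ => (gaussianReal 0 1).real
    (Set.Ico ((n : ℝ) * δ) (((n : ℝ) + 1) * δ)) / δ)).comp h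

instance (δ : ℝ) : NullSingletonClass (flatMeasure δ) := by
  unfold flatMeasure
  infer_instance

theorem map_neg_flatMeasure (δ : ℝ) : (flatMeasure δ).map (fun x => -x) = flatMeasure δ := by
  have hm : Measurable fun z => ENNReal.ofReal (flatDensity δ z) :=
    (measurable_flatDensity δ).ennreal_ofReal
  ext s hs
  rw [Measure.map_apply measurable_neg hs, flatMeasure, withDensity_apply _ (measurable_neg hs),
    withDensity_apply _ hs, ← (Measure.measurePreserving_neg volume).setLIntegral_comp_preimage hs hm]
  simp [flatDensity]

theorem flatMeasure_Ico_of_le {δ s : ℝ} (hδ : 0 < δ) (i : ℕ) (hs : s ≤ ((i : ℝ) + 1) * δ) :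
    flatMeasure δ (Set.Ico ((i : ℝ) * δ) s) = ENNReal.ofReal ((gaussianReal 0 1).real
      (Set.Ico ((i : ℝ) * δ) (((i : ℝ) + 1) * δ)) / δ) * ENNReal.ofReal (s - i * δ) := by
  rw [flatMeasure, withDensity_apply _ measurableSet_Ico,
    setLIntegral_congr_fun (g := fun _ => ENNReal.ofReal ((gaussianReal 0 1).real
      (Set.Ico ((i : ℝ) * δ) (((i : ℝ) + 1) * δ)) / δ)) measurableSet_Ico]
  · simp
  · intro z hz
    simp only [flatDensity, floor_abs_div_eq hδ ⟨hz.1, hz.2.trans_le hs⟩]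

theorem flatMeasure_Ico_zero_mul {δ : ℝ} (hδ : 0 < δ) (i : ℕ) :
    flatMeasure δ (Set.Ico 0 ((i : ℝ) * δ)) = gaussianReal 0 1 (Set.Ico 0 ((i : ℝ) * δ)) := by
  induction i with
  | zero => simp
  | succ i ih =>
    have h0 : 0 ≤ (i : ℝ) * δ := by positivity
    have h1 : (i : ℝ) * δ ≤ ((i : ℝ) + 1) * δ := by gcongr; simp
    push_cast
    rw [← Set.Ico_union_Ico_eq_Ico h0 h1, measure_union (Set.Ico_disjoint_Ico_same) measurableSet_Ico,
      measure_union (Set.Ico_disjoint_Ico_same) measurableSet_Ico, ih,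
      flatMeasure_Ico_of_le hδ i le_rfl, ← ENNReal.ofReal_mul (by positivity)]
    congr 1
    rw [← ofReal_measureReal]
    congr 1
    field_simp
    ring

theorem measure_univ_eq_two_mul_Ici {m : Measure ℝ} [NullSingletonClass m]
    (hm : m.map (fun x => -x) = m) : m Set.univ = 2 * m (Set.Ici 0) := by
  have h : m (Set.Iio 0) = m (Set.Ici 0) := by
    conv_lhs => rw [← hm]
    rw [Measure.map_apply measurable_neg measurableSet_Iio, ← measure_congr Ioi_ae_eq_Ici]
    simp
  rw [← Set.Iio_union_Ici (a := (0 : ℝ)), measure_union ((Set.Iio_disjoint_Ici le_rfl))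
    measurableSet_Ici, h, two_mul]

theorem map_neg_gaussianReal_zero :
    (gaussianReal 0 1).map (fun x => -x) = gaussianReal 0 1 := by
  rw [gaussianReal_map_neg, neg_zero]

theorem flatMeasure_Ici {δ : ℝ} (hδ : 0 < δ) :
    flatMeasure δ (Set.Ici 0) = gaussianReal 0 1 (Set.Ici 0) := by
  have hU : (⋃ i : ℕ, Set.Ico 0 ((i : ℝ) * δ)) = Set.Ici 0 := by
    ext x
    simp only [Set.mem_iUnion, Set.mem_Ico, Set.mem_Ici, exists_and_left, and_iff_left_iff_imp]
    intro _
    obtain ⟨n, hn⟩ := exists_nat_gt (x / δ)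
    exact ⟨n, (div_lt_iff₀ hδ).1 hn⟩
  have hmono : Monotone fun i : ℕ => Set.Ico 0 ((i : ℝ) * δ) := fun i j hij =>
    Set.Ico_subset_Ico_right (by gcongr)
  rw [← hU, hmono.measure_iUnion, hmono.measure_iUnion]
  simp_rw [flatMeasure_Ico_zero_mul hδ]

theorem isProbabilityMeasure_flatMeasure {δ : ℝ} (hδ : 0 < δ) :
    IsProbabilityMeasure (flatMeasure δ) := by
  have := nullSingletonClass_gaussianReal (μ := 0) (v := 1) one_ne_zero
  constructor
  rw [measure_univ_eq_two_mul_Ici (map_neg_flatMeasure δ), flatMeasure_Ici hδ,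
    ← measure_univ_eq_two_mul_Ici map_neg_gaussianReal_zero, measure_univ]

theorem measureReal_Ico_zero_add {m : Measure ℝ} [IsFiniteMeasure m] {a b : ℝ} (ha : 0 ≤ a)
    (hab : a ≤ b) : m.real (Set.Ico 0 b) = m.real (Set.Ico 0 a) + m.real (Set.Ico a b) := by
  rw [← Set.Ico_union_Ico_eq_Ico ha hab, measureReal_union Set.Ico_disjoint_Ico_same
    measurableSet_Ico]

theorem measureReal_flatMeasure_Ico {δ s : ℝ} (hδ : 0 < δ) (i : ℕ) (his : i * δ ≤ s)
    (hs : s ≤ ((i : ℝ) + 1) * δ) :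
    (flatMeasure δ).real (Set.Ico 0 s) = (gaussianReal 0 1).real (Set.Ico 0 (i * δ)) +
      (gaussianReal 0 1).real (Set.Ico ((i : ℝ) * δ) (((i : ℝ) + 1) * δ)) / δ * (s - i * δ) := by
  have := isProbabilityMeasure_flatMeasure hδ
  rw [measureReal_Ico_zero_add (a := i * δ) (by positivity) his, measureReal_def,
    flatMeasure_Ico_zero_mul hδ, measureReal_def, flatMeasure_Ico_of_le hδ i hs, ENNReal.toReal_mul,
    ENNReal.toReal_ofReal (by positivity), ENNReal.toReal_ofReal (by linarith)]
  rfl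

/-! ### Comparison of the two distribution functions -/

theorem exists_nat_mul_le_lt {δ s : ℝ} (hδ : 0 < δ) (hs : 0 ≤ s) :
    ∃ i : ℕ, i * δ ≤ s ∧ s < ((i : ℝ) + 1) * δ :=
  ⟨⌊s / δ⌋₊, (le_div_iff₀ hδ).1 (Nat.floor_le (by positivity)),
    (div_lt_iff₀ hδ).1 (Nat.lt_floor_add_one _)⟩

/-- The distribution function of `flatMeasure` interpolates the concave Gaussian one linearly, so
it lies below. -/
theorem flatMeasure_Ico_le_gaussianReal {δ s : ℝ} (hδ : 0 < δ) (hs : 0 ≤ s) :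
    (flatMeasure δ).real (Set.Ico 0 s) ≤ (gaussianReal 0 1).real (Set.Ico 0 s) := by
  obtain ⟨i, hi, hi'⟩ := exists_nat_mul_le_lt hδ hs
  have h0 : 0 ≤ (i : ℝ) * δ := by positivity
  rw [measureReal_flatMeasure_Ico hδ i hi hi'.le, measureReal_Ico_zero_add h0 hi]
  have h1 := le_measureReal_gaussianReal_Ico h0 hi
  have h2 := measureReal_gaussianReal_Ico_le hs hi'.le
  have h3 : (gaussianReal 0 1).real (Set.Ico ((i : ℝ) * δ) (((i : ℝ) + 1) * δ)) =
      (gaussianReal 0 1).real (Set.Ico ((i : ℝ) * δ) s) +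
      (gaussianReal 0 1).real (Set.Ico s (((i : ℝ) + 1) * δ)) := by
    rw [← Set.Ico_union_Ico_eq_Ico hi hi'.le, measureReal_union Set.Ico_disjoint_Ico_same
      measurableSet_Ico]
  rw [h3]
  gcongr
  rw [div_mul_eq_mul_div, div_le_iff₀ hδ]
  -- Cross-multiplied concavity: the mean density is at least the density at `s` on the left of `s`,
  -- and at most that on the right.
  have h4 := mul_le_mul_of_nonneg_left h1 (sub_nonneg.2 hi'.le)
  have h5 := mul_le_mul_of_nonneg_right h2 (sub_nonneg.2 hi)
  linarith

/-- A lower bound on the slopes of the interpolation makes it dominate the dilated Gaussian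
distribution function. -/
theorem gaussianReal_Ico_le_flatMeasure {δ c s : ℝ} (hδ : 0 < δ) (hc : c ≤ 1)
    (hslope : ∀ i : ℕ, gaussianPDFReal 0 1 (i * δ) * (δ * (1 - (1 - c) * (i + 1))) ≤
      (gaussianReal 0 1).real (Set.Ico ((i : ℝ) * δ) (((i : ℝ) + 1) * δ))) (hs : 0 ≤ s) :
    (gaussianReal 0 1).real (Set.Ico 0 (c * s)) ≤ (flatMeasure δ).real (Set.Ico 0 s) := by
  obtain ⟨i, hi, hi'⟩ := exists_nat_mul_le_lt hδ hs
  have h0 : 0 ≤ (i : ℝ) * δ := by positivity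
  rw [measureReal_flatMeasure_Ico hδ i hi hi'.le]
  -- If the dilated point falls at or before the start of the cell of `s`, the common value at the
  -- grid point `i * δ` already suffices.
  rcases le_total (c * s) (i * δ) with hcs | hcs
  · refine le_add_of_le_of_nonneg (measureReal_mono (Set.Ico_subset_Ico_right hcs)) ?_
    have := sub_nonneg.2 hi
    positivity
  rw [measureReal_Ico_zero_add h0 hcs]
  gcongr
  refine (measureReal_gaussianReal_Ico_le h0 hcs).trans ?_
  rw [div_mul_eq_mul_div, le_div_iff₀ hδ]
  refine le_trans ?_ (mul_le_mul_of_nonneg_right (hslope i) (sub_nonneg.2 hi))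
  rw [mul_assoc, mul_assoc]
  refine mul_le_mul_of_nonneg_left ?_ (gaussianPDFReal_nonneg 0 1 _)
  -- Up to the factor `δ`, this is `(1 - (1 - c) * (i + 1)) * (s - i * δ)` minus `c * s - i * δ`. It
  -- vanishes at `s = (i + 1) * δ`, which dictates the form of `hslope`.
  have hd : 0 ≤ (1 - c) * δ * (i * ((i + 1) * δ - s)) := by
    have := sub_nonneg.2 hc
    have := sub_nonneg.2 hi'.le
    positivity
  linarith

/-! ### Comparison of seminorm integrals -/

theorem lintegral_stdGaussianProd_le_flatProd {δ : ℝ} (hδ : 0 < δ) (k : ℕ)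
    (φ : Seminorm ℝ (Fin k → ℝ)) :
    ∫⁻ x, ENNReal.ofReal (φ x) ∂(stdGaussianProd k) ≤
      ∫⁻ x, ENNReal.ofReal (φ x) ∂(flatProd k δ) := by
  have := isProbabilityMeasure_flatMeasure hδ
  have := nullSingletonClass_gaussianReal (μ := 0) (v := 1) one_ne_zero
  exact lintegral_pi_le_of_convexOn map_neg_gaussianReal_zero (map_neg_flatMeasure δ)
    (fun s hs => measure_lt_abs_le map_neg_gaussianReal_zero (map_neg_flatMeasure δ) hs hs
      (flatMeasure_Ico_le_gaussianReal hδ hs)) k φ.convexOn (fun x => apply_nonneg φ x)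

/-- The comparison is applied to the flat law pushed forward by `x ↦ c * x`; its product is the
image of `flatProd` under scaling by `c`, and the seminorm pulls `c` out. -/
theorem lintegral_flatProd_le_stdGaussianProd {δ c : ℝ} (hδ : 0 < δ) (hc : 0 < c) (hc1 : c ≤ 1)
    (hslope : ∀ i : ℕ, gaussianPDFReal 0 1 (i * δ) * (δ * (1 - (1 - c) * (i + 1))) ≤
      (gaussianReal 0 1).real (Set.Ico ((i : ℝ) * δ) (((i : ℝ) + 1) * δ)))
    (k : ℕ) (φ : Seminorm ℝ (Fin k → ℝ)) :
    ENNReal.ofReal c * ∫⁻ x, ENNReal.ofReal (φ x) ∂(flatProd k δ) ≤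
      ∫⁻ x, ENNReal.ofReal (φ x) ∂(stdGaussianProd k) := by
  have := isProbabilityMeasure_flatMeasure hδ
  have := nullSingletonClass_gaussianReal (μ := 0) (v := 1) one_ne_zero
  have hφ : Measurable φ := φ.convexOn.continuous_of_univ.measurable
  have hmul : Measurable fun x : ℝ => c * x := measurable_const_mul c
  set m : Measure ℝ := (flatMeasure δ).map fun x => c * x with hm
  have : IsProbabilityMeasure m := Measure.isProbabilityMeasure_map hmul.aemeasurable
  have hsymm : m.map (fun x => -x) = m := by
    conv_rhs => rw [hm, ← map_neg_flatMeasure δ]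
    rw [hm, Measure.map_map measurable_neg hmul, Measure.map_map hmul measurable_neg]
    congr 1
    ext x
    simp
  have hle (s : ℝ) (hs : 0 ≤ s) : m {x | s < |x|} ≤ gaussianReal 0 1 {x | s < |x|} := by
    have hpre : (fun x : ℝ => c * x) ⁻¹' {x | s < |x|} = {x | s / c < |x|} := by
      ext x
      simp [abs_mul, abs_of_pos hc, div_lt_iff₀' hc]
    have hmeas : MeasurableSet {x : ℝ | s < |x|} := measurableSet_lt measurable_const measurable_norm
    rw [hm, Measure.map_apply hmul hmeas, hpre]
    refine measure_lt_abs_le (map_neg_flatMeasure δ) map_neg_gaussianReal_zero (by positivity) hs ?_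
    have := gaussianReal_Ico_le_flatMeasure hδ hc1 hslope (s := s / c) (by positivity)
    rwa [mul_div_cancel₀ _ hc.ne'] at this
  have hpi : (Measure.pi fun _ : Fin k => m) = (flatProd k δ).map fun x => c • x :=
    (Measure.pi_map_pi (μ := fun _ : Fin k => flatMeasure δ) (f := fun _ x => c * x)
      fun _ => hmul.aemeasurable).symm
  have h := lintegral_pi_le_of_convexOn hsymm map_neg_gaussianReal_zero hle k φ.convexOn
    (fun x => apply_nonneg φ x)
  rw [hpi, lintegral_map hφ.ennreal_ofReal (measurable_const_smul c)] at h
  simp_rw [map_smul_eq_mul, Real.norm_of_nonneg hc.le, ENNReal.ofReal_mul hc.le] at h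
  rwa [lintegral_const_mul _ hφ.ennreal_ofReal] at h

/-! ### Lower bounds for the masses of cells -/

/-- Gives finiteness of the flat expectation for every `δ`, including `ε ≥ 1`, where `1 - ε` is no
admissible dilation. Taking `c ≤ 1 / 2` makes the left side nonpositive for `i ≥ 1`; the other bound
on `c` handles `i = 0`. -/
theorem exists_slope_bound {δ : ℝ} (hδ : 0 < δ) : ∃ c : ℝ, 0 < c ∧ c ≤ 1 ∧
    ∀ i : ℕ, gaussianPDFReal 0 1 (i * δ) * (δ * (1 - (1 - c) * (i + 1))) ≤
      (gaussianReal 0 1).real (Set.Ico ((i : ℝ) * δ) (((i : ℝ) + 1) * δ)) := by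
  have hp (x : ℝ) : 0 < gaussianPDFReal 0 1 x := gaussianPDFReal_pos 0 1 x one_ne_zero
  have hpos : 0 < (gaussianReal 0 1).real (Set.Ico 0 δ) := by
    refine lt_of_lt_of_le ?_ (le_measureReal_gaussianReal_Ico le_rfl hδ.le)
    rw [sub_zero]
    exact mul_pos (hp δ) hδ
  have hq : 0 < gaussianPDFReal 0 1 0 * δ := mul_pos (hp 0) hδ
  refine ⟨min (1 / 2) ((gaussianReal 0 1).real (Set.Ico 0 δ) / (gaussianPDFReal 0 1 0 * δ)),
    lt_min (by norm_num) (div_pos hpos hq), (min_le_left _ _).trans (by norm_num), fun i => ?_⟩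
  set c := min (1 / 2) ((gaussianReal 0 1).real (Set.Ico 0 δ) / (gaussianPDFReal 0 1 0 * δ))
  have hc : c ≤ 1 / 2 := min_le_left _ _
  rcases Nat.eq_zero_or_pos i with rfl | hi
  · have := (le_div_iff₀ hq).1 (min_le_right _ _ : c ≤ _)
    simp only [Nat.cast_zero, zero_mul, zero_add, one_mul, mul_one]
    linarith
  · have hi' : (1 : ℝ) ≤ i := by exact_mod_cast hi
    refine le_trans (mul_nonpos_of_nonneg_of_nonpos (hp _).le ?_) measureReal_nonneg
    exact mul_nonpos_of_nonneg_of_nonpos hδ.le (by nlinarith)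

theorem slope_bound {ε δ : ℝ} (hε : 0 < ε) (hε1 : ε < 1) (hδ : 0 < δ) (hδε : δ ^ 2 = 8 * ε ^ 3)
    (i : ℕ) : gaussianPDFReal 0 1 (i * δ) * (δ * (1 - ε * (i + 1))) ≤
      (gaussianReal 0 1).real (Set.Ico ((i : ℝ) * δ) (((i : ℝ) + 1) * δ)) := by
  have hp (x : ℝ) : 0 ≤ gaussianPDFReal 0 1 x := gaussianPDFReal_nonneg 0 1 x
  have hi0 : (0 : ℝ) ≤ i := Nat.cast_nonneg i
  rcases le_total ε (1 / 2) with hhalf | hhalf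
  · refine le_trans (mul_le_mul_of_nonneg_left ?_ (hp _))
      (le_measureReal_gaussianReal_Ico_of_cubic (by gcongr; simp))
    -- On the `i`-th cell the bracket of the cubic bound equals `δ * (1 - δ ^ 2 / 2 * (i + 1 / 3))`.
    have key : δ * (δ ^ 2 / 2 * (i + 1 / 3)) ≤ δ * (ε * (i + 1)) := by
      refine mul_le_mul_of_nonneg_left ?_ hδ.le
      have h1 : ε ^ 2 ≤ 1 / 4 := by nlinarith
      calc δ ^ 2 / 2 * (i + 1 / 3) = ε * (4 * ε ^ 2 * (i + 1 / 3)) := by rw [hδε]; ring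
        _ ≤ ε * (1 * (i + 1)) := by gcongr <;> linarith
        _ = ε * (i + 1) := by ring
    linarith
  rcases Nat.eq_zero_or_pos i with rfl | hi
  -- For large `ε` the interval `[0, 1)` is enough: the cubic bound gives it mass at least `1 - 1 /
  -- 6 = 5 / 6` times the density at `0`.
  · have h1δ : 1 ≤ δ := by
      have : (1 / 2) ^ 3 ≤ ε ^ 3 := by gcongr
      nlinarith
    have hbound : δ * (1 - ε) ≤ 5 / 6 := by
      refine abs_le_of_sq_le_sq' ?_ (by norm_num) |>.2
      have h4 : ε * (1 - ε) ≤ 1 / 4 := by nlinarith [sq_nonneg (ε - 1 / 2)]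
      have h5 : 0 ≤ ε * (1 - ε) := mul_nonneg hε.le (by linarith)
      calc (δ * (1 - ε)) ^ 2 = 8 * ε * (ε * (1 - ε)) ^ 2 := by rw [mul_pow, hδε]; ring
        _ ≤ 8 * 1 * (1 / 4) ^ 2 := by gcongr
        _ ≤ (5 / 6) ^ 2 := by norm_num
    have h01 := le_measureReal_gaussianReal_Ico_of_cubic (u := 0) (v := 1) zero_le_one
    have hsub : (gaussianReal 0 1).real (Set.Ico 0 1) ≤ (gaussianReal 0 1).real (Set.Ico 0 δ) :=
      measureReal_mono (Set.Ico_subset_Ico_right h1δ)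
    have := mul_le_mul_of_nonneg_left hbound (hp 0)
    simp only [Nat.cast_zero, zero_mul, zero_add, one_mul, mul_one]
    linarith
  -- Here `ε * (i + 1) ≥ 1`, so the left side is nonpositive.
  · have hi' : (1 : ℝ) ≤ i := by exact_mod_cast hi
    refine le_trans (mul_nonpos_of_nonneg_of_nonpos (hp _) ?_) measureReal_nonneg
    exact mul_nonpos_of_nonneg_of_nonpos hδ.le (by nlinarith)

/-! ### Integrability and conclusion -/

theorem integrable_seminorm_stdGaussianProd (k : ℕ) (φ : Seminorm ℝ (Fin k → ℝ)) :
    Integrable (fun x => φ x) (stdGaussianProd k) := by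
  have hφ : Continuous φ := φ.convexOn.continuous_of_univ
  have hid : Integrable (fun x : ℝ => x) (gaussianReal 0 1) :=
    IsGaussian.integrable_id
  have hsum : Integrable (fun x : Fin k → ℝ => ∑ i, |x i| * φ (Pi.single i 1))
      (stdGaussianProd k) :=
    integrable_finsetSum _ fun i _ =>
      ((integrable_comp_eval (μ := fun _ : Fin k => gaussianReal 0 1) (i := i)
        (f := fun x : ℝ => |x|) hid.abs).mul_const _)
  refine hsum.mono' hφ.aestronglyMeasurable (ae_of_all _ fun x => ?_)
  rw [Real.norm_of_nonneg (apply_nonneg φ x)]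
  calc φ x = φ (∑ i, x i • Pi.single i (1 : ℝ)) := by rw [← pi_eq_sum_univ' x]
    _ ≤ ∑ i, φ (x i • Pi.single i (1 : ℝ)) := 
        Finset.le_sum_of_subadditive φ (map_zero φ).le (fun x y => map_add_le_add φ x y) _ _
    _ = ∑ i, |x i| * φ (Pi.single i 1) := by simp_rw [map_smul_eq_mul, Real.norm_eq_abs]

theorem lemma4p2 (ε : ℝ) (hε : 0 < ε) (δ : ℝ) (hδ : δ = (2 * ε) ^ (3 / 2 : ℝ)) :
    IsProbabilityMeasure (flatMeasure δ) ∧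
    ∀ (k : ℕ) (φ : Seminorm ℝ (Fin k → ℝ)),
      Integrable (fun x => φ x) (flatProd k δ) ∧
      Integrable (fun x => φ x) (stdGaussianProd k) ∧
      (1 - ε) * ∫ x, φ x ∂(flatProd k δ) ≤ ∫ z, φ z ∂(stdGaussianProd k) ∧
      ∫ z, φ z ∂(stdGaussianProd k) ≤ ∫ x, φ x ∂(flatProd k δ) := by
  have hδ0 : 0 < δ := hδ ▸ Real.rpow_pos_of_pos (by positivity) _
  have hδε : δ ^ 2 = 8 * ε ^ 3 := by
    rw [hδ, ← Real.rpow_natCast, ← Real.rpow_mul (by positivity)]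
    norm_num
    ring
  refine ⟨isProbabilityMeasure_flatMeasure hδ0, fun k φ => ?_⟩
  have hφ : Continuous φ := φ.convexOn.continuous_of_univ
  have hγ := integrable_seminorm_stdGaussianProd k φ
  have hnn (m : Measure (Fin k → ℝ)) : 0 ≤ᵐ[m] fun x => φ x := ae_of_all _ fun x => apply_nonneg φ x
  have hγtop : ∫⁻ x, ENNReal.ofReal (φ x) ∂(stdGaussianProd k) < ⊤ :=
    (hasFiniteIntegral_iff_ofReal (hnn _)).1 hγ.2
  have hflattop : ∫⁻ x, ENNReal.ofReal (φ x) ∂(flatProd k δ) < ⊤ := by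
    -- Finiteness transfers from the Gaussian side through any positive dilation factor.
    obtain ⟨c, hc, hc1, hslope⟩ := exists_slope_bound hδ0
    have h := (lintegral_flatProd_le_stdGaussianProd hδ0 hc hc1 hslope k φ).trans_lt hγtop
    exact ENNReal.lt_top_of_mul_ne_top_right h.ne (by simpa using hc)
  have hflat : Integrable (fun x => φ x) (flatProd k δ) :=
    ⟨hφ.aestronglyMeasurable, (hasFiniteIntegral_iff_ofReal (hnn _)).2 hflattop⟩
  refine ⟨hflat, hγ, ?_, ?_⟩
  · rcases lt_or_ge ε 1 with hε1 | hε1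
    · have h := lintegral_flatProd_le_stdGaussianProd hδ0 (c := 1 - ε) (by linarith) (by linarith)
        (fun i => by simpa using slope_bound hε hε1 hδ0 hδε i) k φ
      have h' := ENNReal.toReal_mono hγtop.ne h
      rw [ENNReal.toReal_mul, ENNReal.toReal_ofReal (by linarith)] at h'
      rwa [integral_eq_lintegral_of_nonneg_ae (hnn _) hφ.aestronglyMeasurable,
        integral_eq_lintegral_of_nonneg_ae (hnn _) hφ.aestronglyMeasurable]
    -- For `ε ≥ 1` the left side is nonpositive and the Gaussian expectation is nonnegative.
    · exact (mul_nonpos_of_nonpos_of_nonneg (by linarith)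
        (integral_nonneg fun x => apply_nonneg φ x)).trans
        (integral_nonneg fun x => apply_nonneg φ x)
  · rw [integral_eq_lintegral_of_nonneg_ae (hnn _) hφ.aestronglyMeasurable,
      integral_eq_lintegral_of_nonneg_ae (hnn _) hφ.aestronglyMeasurable]
    exact ENNReal.toReal_mono hflattop.ne (lintegral_stdGaussianProd_le_flatProd hδ0 k φ)
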